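/- Let $\mathcal B$ be a Boolean algebra (with least element $\emptyset$, a largest element is not required). An action on $\mathcal B$ is a Boolean algebra homomorphism $\theta:\mathcal B\to\mathcal B$ with $\theta(\emptyset)=\emptyset$. A Boolean dynamical system $(\mathcal B,\mathcal L,\theta)$ consists of a set $\mathcal L$ and actions $\theta_a$ ($a\in\mathcal L$) such that, for every nonempty word $\alpha=\alpha_1\cdots\alpha_n$ in $\mathcal L$, the map $\theta_\alpha=\theta_{\alpha_n}\circ\cdots\circ\theta_{\alpha_1}$ has compact range (the set $\theta_\alpha(\mathcal B)$ has a least upper bound $\mathcal R_\alpha$) and closed domain (there is $\mathcal D_\alpha\in\mathcal B$ with $\theta_\alpha(\mathcal D_\alpha)=\mathcal R_\alpha$). For the empty word put $\theta_\emptyset=\mathrm{id}$ and let $\mathcal R_\emptyset$ be a formal largest element. For $A\in\mathcal B$ let $\Delta_A=\{a\in\mathcal L:\theta_a(A)\neq\emptyset\}$, and call $A$ regular if $0<|\Delta_X|<\infty$ for every $\emptyset\ne X\subseteq A$. Let $C^*(\mathcal B,\mathcal L,\theta)$ be the universal C*-algebra generated by projections $p_A$ ($A\in\mathcal B$) and partial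 isometries $s_a$ ($a\in\mathcal L$) subject to $p_\emptyset=0$, $p_Ap_{A'}=p_{A\cap A'}$, $p_{A\cup A'}=p_A+p_{A'}-p_{A\cap A'}$, $p_As_a=s_ap_{\theta_a(A)}$, $s_a^*s_b=\delta_{a,b}\,p_{\mathcal R_a}$, and $p_A=\sum_{a\in\Delta_A}s_ap_{\theta_a(A)}s_a^*$ for every regular $A$. For a word $\alpha=\alpha_1\cdots\alpha_n$ of length $|\alpha|=n$ write $s_\alpha=s_{\alpha_1}\cdots s_{\alpha_n}$ (with $s_\emptyset$ acting as the identity), and let $T$ be the inverse semigroup $$T=\{s_\alpha p_As_\beta^*:\ \alpha,\beta \text{ words},\ A\in\mathcal B,\ A\subseteq\mathcal R_\alpha\cap\mathcal R_\beta\neq\emptyset\}\cup\{0\}\subseteq C^*(\mathcal B,\mathcal L,\theta).$$ A filter in the semilattice of idempotents of $T$ (nonempty, upward closed, closed under products, not containing $0$) is tight if it meets every finite cover of each of its members; a cover of an idempotent $e$ is a set $Z$ of idempotents $\le e$ such that every nonzero idempotent $f\le e$ satisfies $zf\ne0$ for some $z\in Z$. Let $\mathcal G_{tight}(T)$ be the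 groupoid of germs $[t,\xi]$ ($t\in T$, $\xi$ a tight filter, $t^*t\in\xi$) of the action of $T$ on its tight filters, where $t\cdot\xi$ is the set of idempotents $e$ with $tft^*\le e$ for some $f\in\xi$, and $[t,\xi]=[t',\xi']$ iff $\xi=\xi'$ and $te=t'e$ for some $e\in\xi$; $[t,\xi]$ has source $\xi$ and range $t\cdot\xi$. Let $c:\mathcal G_{tight}(T)\to\mathbb Z$ be the cocycle $c([s_\alpha p_As_\beta^*,\xi])=|\alpha|-|\beta|$. Then the subgroupoid $c^{-1}(0)$ of $\mathcal G_{tight}(T)$ is principal: every element of $c^{-1}(0)$ whose source and range coincide is a unit (so the isotropy bundle of $c^{-1}(0)$ equals its unit space). -/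

import Mathlib

open CategoryTheory

universe u v w

/-! ### Inverse semigroups with zero and their tight groupoids -/

/-- An inverse semigroup with zero, presented equationally: `star x` is the (unique) generalised
inverse of `x`.  The axioms (involutive anti-multiplicative `star`, `x x* x = x`, and commutation of
the elements `x x*`) are the standard equational axioms of inverse semigroups. -/
class InverseSemigroup₀ (S : Type w) extends SemigroupWithZero S, StarMul S where
  mul_star_mul : ∀ x : S, x * star x * x = x
  comm_proj : ∀ x y : S, (x * star x) * (y * star y) = (y * star y) * (x * star x)

namespace InverseSemigroup₀

variable {S : Type w} [InverseSemigroup₀ S]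

theorem star_idem {e : S} (he : e * e = e) : star e = e := by
  have h1 : star e * star e = star e := by rw [← star_mul, he]
  have h2 : e * star e * e = e := mul_star_mul e
  have h3 := comm_proj e (star e)
  rw [star_star] at h3
  have h4 : e = e * star e * (star e * e) := by
    calc e = e * star e * e := h2.symm
      _ = e * (star e * star e) * e := by rw [h1]
      _ = e * star e * (star e * e) := by simp only [mul_assoc]
  have h5 : star e * e * (e * star e) = star e := by
    calc star e * e * (e * star e) = star e * (e * e) * star e := by simp only [mul_assoc]
      _ = star e * e * star e := by rw [he]
      _ = star e := by simpa using mul_star_mul (star e)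
  rw [h3, h5] at h4
  exact h4.symm

theorem idem_comm {e f : S} (he : e * e = e) (hf : f * f = f) : e * f = f * e := by
  have h := comm_proj e f
  rwa [star_idem he, star_idem hf, he, hf] at h

theorem idem_mul {e f : S} (he : e * e = e) (hf : f * f = f) : e * f * (e * f) = e * f := by
  calc e * f * (e * f) = e * (f * e) * f := by simp only [mul_assoc]
    _ = e * (e * f) * f := by rw [idem_comm he hf]
    _ = (e * e) * (f * f) := by simp only [mul_assoc]
    _ = e * f := by rw [he, hf]

theorem idem_star_mul (s : S) : star s * s * (star s * s) = star s * s := by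
  rw [← mul_assoc, mul_assoc (star s) s (star s), mul_assoc (star s), mul_star_mul]

theorem conj_mul (s : S) {f : S} (hf : f * f = f) : s * f * star s * s = s * f := by
  calc s * f * star s * s = s * (f * (star s * s)) := by simp only [mul_assoc]
    _ = s * (star s * s * f) := by rw [idem_comm hf (idem_star_mul s)]
    _ = (s * star s * s) * f := by simp only [mul_assoc]
    _ = s * f := by rw [mul_star_mul]

theorem conj_mul_conj (s : S) {f : S} (hf : f * f = f) (g : S) :
    s * f * star s * (s * g * star s) = s * (f * g) * star s := by
  calc s * f * star s * (s * g * star s) = (s * f * star s * s) * (g * star s) := by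
        simp only [mul_assoc]
    _ = s * (f * g) * star s := by rw [conj_mul s hf]; simp only [mul_assoc]

theorem idem_conj (s : S) {f : S} (hf : f * f = f) :
    s * f * star s * (s * f * star s) = s * f * star s := by
  rw [conj_mul_conj s hf, hf]

/-- A (proper) filter in the semilattice of idempotents of `S`; recall that the order on
idempotents is `e ≤ f ↔ e * f = e`. -/
structure IsFilter (ξ : Set S) : Prop where
  idem : ∀ e ∈ ξ, e * e = e
  nonempty : ξ.Nonempty
  zero_notMem : (0 : S) ∉ ξ
  mul_mem : ∀ e ∈ ξ, ∀ f ∈ ξ, e * f ∈ ξ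
  upward : ∀ e ∈ ξ, ∀ f : S, f * f = f → e * f = e → f ∈ ξ

/-- `Z` is a cover of the idempotent `e`: it consists of idempotents `≤ e`, and every nonzero
idempotent `f ≤ e` meets some member of `Z`. -/
structure IsCover (Z : Set S) (e : S) : Prop where
  idem : ∀ z ∈ Z, z * z = z
  le : ∀ z ∈ Z, z * e = z
  meets : ∀ f : S, f * f = f → f ≠ 0 → f * e = f → ∃ z ∈ Z, z * f ≠ 0

variable (S) in
/-- Tight filters: filters `ξ` such that every finite cover of a member of `ξ` meets `ξ`. -/
@[ext]
structure TightFilter where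
  carrier : Set S
  isFilter : IsFilter carrier
  tight : ∀ e ∈ carrier, ∀ Z : Set S, Z.Finite → IsCover Z e → ∃ z ∈ Z, z ∈ carrier

/-- The set `s · ξ = {e idempotent : ∃ f ∈ ξ, s f s* ≤ e}`. -/
def actSet (s : S) (ξ : Set S) : Set S :=
  {e | e * e = e ∧ ∃ f ∈ ξ, s * f * star s * e = s * f * star s}

theorem conj_mem_actSet (s : S) {ξ : Set S} (hξ : IsFilter ξ) {f : S} (hf : f ∈ ξ) :
    s * f * star s ∈ actSet s ξ :=
  ⟨idem_conj s (hξ.idem f hf), f, hf, idem_conj s (hξ.idem f hf)⟩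

theorem isFilter_actSet {s : S} {ξ : Set S} (hξ : IsFilter ξ) (hs : star s * s ∈ ξ) :
    IsFilter (actSet s ξ) where
  idem e he := he.1
  nonempty := ⟨_, conj_mem_actSet s hξ hs⟩
  zero_notMem := by
    rintro ⟨-, f, hf, h⟩
    rw [mul_zero] at h
    apply hξ.zero_notMem
    have h2 : star s * s * f * (star s * s) = star s * (s * f * star s) * s := by
      simp only [mul_assoc]
    rw [← h, mul_zero, zero_mul] at h2
    rw [← h2]
    exact hξ.mul_mem _ (hξ.mul_mem _ hs _ hf) _ hs
  mul_mem := by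
    rintro e ⟨he, f, hf, h⟩ e' ⟨he', f', hf', h'⟩
    refine ⟨idem_mul he he', f * f', hξ.mul_mem _ hf _ hf', ?_⟩
    rw [← conj_mul_conj s (hξ.idem f hf)]
    set a := s * f * star s
    set b := s * f' * star s
    have hb : b * b = b := idem_conj s (hξ.idem f' hf')
    calc a * b * (e * e') = a * (b * e) * e' := by simp only [mul_assoc]
      _ = a * (e * b) * e' := by rw [idem_comm hb he]
      _ = (a * e) * (b * e') := by simp only [mul_assoc]
      _ = a * b := by rw [h, h']
  upward := by
    rintro e ⟨he, f, hf, h⟩ g hg heg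
    refine ⟨hg, f, hf, ?_⟩
    rw [← h, mul_assoc, heg]

/-- The action of `S` on tight filters: for `s* s ∈ ξ`, the tight filter `s · ξ`. -/
def TightFilter.act (s : S) (ξ : TightFilter S) (hs : star s * s ∈ ξ.carrier) : TightFilter S where
  carrier := actSet s ξ.carrier
  isFilter := isFilter_actSet ξ.isFilter hs
  tight := by
    rintro e ⟨he, f₀, hf₀, h₀⟩ Z hZ hc
    have hi0 := ξ.isFilter.idem f₀ hf₀
    have hss := idem_star_mul s
    set f := f₀ * (star s * s) with hfdef
    have hf : f ∈ ξ.carrier := ξ.isFilter.mul_mem _ hf₀ _ hs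
    have hi := ξ.isFilter.idem f hf
    have hfs : f * (star s * s) = f := by rw [hfdef, mul_assoc, hss]
    have hsf : star s * s * f = f := by rw [← idem_comm hi hss, hfs]
    have hle : s * f * star s * e = s * f * star s := by
      rw [hfdef, ← conj_mul_conj s hi0]
      have hb := idem_conj s hss
      rw [mul_assoc, idem_comm hb he, ← mul_assoc, h₀]
    have hpull : ∀ z ∈ Z, star s * z * s * (star s * z * s) = star s * z * s := fun z hz => by
      simpa using idem_conj (star s) (hc.idem z hz)
    have hcov : IsCover ((fun z => star s * z * s * f) '' Z) f := by
      refine ⟨?_, ?_, ?_⟩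
      · rintro _ ⟨z, hz, rfl⟩
        exact idem_mul (hpull z hz) hi
      · rintro _ ⟨z, hz, rfl⟩
        change star s * z * s * f * f = star s * z * s * f
        rw [mul_assoc, hi]
      · intro g hg hg0 hgf
        have hfg : f * g = g := by rw [idem_comm hi hg, hgf]
        have hgss : star s * s * g = g := by rw [← hfg, ← mul_assoc, hsf]
        have hgss' : g * (star s * s) = g := by rw [idem_comm hg hss, hgss]
        have hne : s * g * star s ≠ 0 := by
          intro h
          apply hg0
          calc g = star s * s * g * (star s * s) := by rw [hgss, hgss']
            _ = star s * (s * g * star s) * s := by simp only [mul_assoc]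
            _ = 0 := by rw [h, mul_zero, zero_mul]
        have hge : s * g * star s * e = s * g * star s := by
          conv_lhs => rw [← hgf]
          rw [← conj_mul_conj s hg, mul_assoc, hle, conj_mul_conj s hg, hgf]
        obtain ⟨z, hz, hzg⟩ := hc.meets _ (idem_conj s hg) hne hge
        refine ⟨_, ⟨z, hz, rfl⟩, ?_⟩
        intro h
        apply hzg
        change star s * z * s * f * g = 0 at h
        have hzi := hc.idem z hz
        have hss' : s * star s * (s * star s) = s * star s := by
          simpa using idem_star_mul (star s)
        calc z * (s * g * star s) = z * (s * star s * s * g * star s) := by rw [mul_star_mul]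
          _ = z * (s * star s) * (s * g * star s) := by simp only [mul_assoc]
          _ = s * star s * z * (s * g * star s) := by rw [idem_comm hzi hss']
          _ = s * (star s * z * s * g) * star s := by simp only [mul_assoc]
          _ = s * (star s * z * s * f * g) * star s := by rw [mul_assoc _ f g, hfg]
          _ = 0 := by rw [h, mul_zero, zero_mul]
    obtain ⟨_, ⟨z, hz, rfl⟩, hzξ⟩ := ξ.tight f hf _ (hZ.image _) hcov
    refine ⟨z, hz, hc.idem z hz, _, hzξ, ?_⟩
    have hzi := hc.idem z hz
    have hss' : s * star s * (s * star s) = s * star s := by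
      simpa using idem_star_mul (star s)
    have key : s * (star s * z * s * f) * star s = z * (s * f * star s) := by
      calc s * (star s * z * s * f) * star s = s * star s * z * (s * f * star s) := by
            simp only [mul_assoc]
        _ = z * (s * star s) * (s * f * star s) := by rw [idem_comm hzi hss']
        _ = z * ((s * star s * s) * f * star s) := by simp only [mul_assoc]
        _ = z * (s * f * star s) := by rw [mul_star_mul]
    change s * (star s * z * s * f) * star s * z = s * (star s * z * s * f) * star s
    rw [key, mul_assoc, idem_comm (idem_conj s hi) hzi, ← mul_assoc, hzi]

theorem actSet_mul (t s : S) {ξ : Set S} (hξ : IsFilter ξ) :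
    actSet (t * s) ξ = actSet t (actSet s ξ) := by
  have e1 : ∀ f : S, t * s * f * star (t * s) = t * (s * f * star s) * star t := fun f => by
    rw [star_mul]; simp only [mul_assoc]
  ext e
  constructor
  · rintro ⟨he, f, hf, h⟩
    exact ⟨he, _, conj_mem_actSet s hξ hf, by rw [← e1, h]⟩
  · rintro ⟨he, f', ⟨hf', f, hf, h'⟩, h⟩
    refine ⟨he, f, hf, ?_⟩
    have hi := idem_conj s (hξ.idem f hf)
    rw [e1, ← h', ← conj_mul_conj t hi, mul_assoc, h]

theorem actSet_idem {ξ : Set S} (hξ : IsFilter ξ) {e : S} (he : e ∈ ξ) : actSet e ξ = ξ := by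
  have hi := hξ.idem e he
  ext g
  constructor
  · rintro ⟨hg, f, hf, h⟩
    rw [star_idem hi] at h
    exact hξ.upward _ (hξ.mul_mem _ (hξ.mul_mem _ he _ hf) _ he) g hg h
  · intro hg
    have hgi := hξ.idem g hg
    refine ⟨hgi, g, hg, ?_⟩
    rw [star_idem hi, mul_assoc (e * g), idem_comm hi hgi, mul_assoc g e (g * e), ← mul_assoc e g e,
      ← idem_comm hgi hi, mul_assoc g e e, hi, ← mul_assoc g g e, hgi]

theorem actSet_star {s : S} {ξ : Set S} (hξ : IsFilter ξ) (hs : star s * s ∈ ξ) :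
    actSet (star s) (actSet s ξ) = ξ := by
  rw [← actSet_mul _ _ hξ, actSet_idem hξ hs]

theorem mul_mem_of_mem_actSet {s g : S} {ξ : Set S} (hξ : IsFilter ξ) (hs : star s * s ∈ ξ)
    (hg : g ∈ actSet s ξ) : star s * g * s ∈ ξ := by
  have h := conj_mem_actSet (star s) (isFilter_actSet hξ hs) hg
  rwa [actSet_star hξ hs, star_star] at h

/-- Pairs `(s, ξ)` with `s* s ∈ ξ` representing the same germ have the same range, so that the range
of a germ is well defined. -/
theorem actSet_congr {s t e : S} {ξ : Set S} (hξ : IsFilter ξ) (he : e ∈ ξ)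
    (h : s * e = t * e) : actSet s ξ = actSet t ξ := by
  rw [← actSet_idem hξ he, ← actSet_mul _ _ hξ, ← actSet_mul _ _ hξ, h]

/-- Elements `s` with `s* s ∈ ξ` and `s · ξ = η`. -/
@[ext]
structure PreHom (ξ η : TightFilter S) : Type w where
  val : S
  dom : star val * val ∈ ξ.carrier
  act_eq : actSet val ξ.carrier = η.carrier

/-- Equality of germs: `[s, ξ] = [t, ξ]` iff `s e = t e` for some `e ∈ ξ`. -/
instance germSetoid (ξ η : TightFilter S) : Setoid (PreHom ξ η) where
  r s t := ∃ e ∈ ξ.carrier, s.val * e = t.val * e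
  iseqv :=
    { refl := fun _ => ⟨_, ξ.isFilter.nonempty.some_mem, rfl⟩
      symm := fun ⟨e, he, h⟩ => ⟨e, he, h.symm⟩
      trans := by
        rintro s t r ⟨e, he, h⟩ ⟨f, hf, h'⟩
        refine ⟨e * f, ξ.isFilter.mul_mem _ he _ hf, ?_⟩
        rw [← mul_assoc, h, idem_comm (ξ.isFilter.idem e he) (ξ.isFilter.idem f hf),
          mul_assoc, idem_comm (ξ.isFilter.idem e he) (ξ.isFilter.idem f hf), ← mul_assoc, h',
          mul_assoc] }

/-- The germs `[s, ξ]` with source `ξ` and range `s · ξ = η`. -/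
def Germ (ξ η : TightFilter S) : Type w := Quotient (germSetoid ξ η)

noncomputable def PreHom.one (ξ : TightFilter S) : PreHom ξ ξ where
  val := ξ.isFilter.nonempty.some
  dom := by
    have h := ξ.isFilter.nonempty.some_mem
    have hi := ξ.isFilter.idem _ h
    rw [star_idem hi, hi]; exact h
  act_eq := actSet_idem ξ.isFilter ξ.isFilter.nonempty.some_mem

def PreHom.comp {ξ η ζ : TightFilter S} (s : PreHom ξ η) (t : PreHom η ζ) : PreHom ξ ζ where
  val := t.val * s.val
  dom := by
    have h : star t.val * t.val ∈ actSet s.val ξ.carrier := by rw [s.act_eq]; exact t.dom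
    have := mul_mem_of_mem_actSet ξ.isFilter s.dom h
    rw [star_mul]
    simpa only [mul_assoc] using this
  act_eq := by rw [actSet_mul _ _ ξ.isFilter, s.act_eq, t.act_eq]

theorem PreHom.range_mem {ξ η : TightFilter S} (s : PreHom ξ η) :
    s.val * star s.val ∈ η.carrier := by
  rw [← s.act_eq]
  have := conj_mem_actSet s.val ξ.isFilter s.dom
  rwa [← mul_assoc s.val, mul_star_mul] at this

def PreHom.inv {ξ η : TightFilter S} (s : PreHom ξ η) : PreHom η ξ where
  val := star s.val
  dom := by rw [star_star]; exact s.range_mem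
  act_eq := by rw [← s.act_eq, actSet_star ξ.isFilter s.dom]

theorem PreHom.comp_congr {ξ η ζ : TightFilter S} {s s' : PreHom ξ η} {t t' : PreHom η ζ}
    (hs : s ≈ s') (ht : t ≈ t') : s.comp t ≈ s'.comp t' := by
  obtain ⟨e, he, h⟩ := hs
  obtain ⟨f, hf, h'⟩ := ht
  rw [← s.act_eq] at hf
  obtain ⟨hfi, k, hk, hkf⟩ := hf
  have hki := ξ.isFilter.idem k hk
  have hei := ξ.isFilter.idem e he
  refine ⟨k * e, ξ.isFilter.mul_mem _ hk _ he, ?_⟩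
  change t.val * s.val * (k * e) = t'.val * s'.val * (k * e)
  have h1 : f * (s.val * k) = s.val * k := by
    rw [← conj_mul s.val hki, ← mul_assoc f, idem_comm hfi (idem_conj s.val hki), hkf]
  calc t.val * s.val * (k * e) = t.val * (s.val * k) * e := by simp only [mul_assoc]
    _ = t.val * (f * (s.val * k)) * e := by rw [h1]
    _ = (t.val * f) * (s.val * k) * e := by simp only [mul_assoc]
    _ = t'.val * (f * (s.val * k)) * e := by rw [h']; simp only [mul_assoc]
    _ = t'.val * (s.val * (k * e)) := by rw [h1]; simp only [mul_assoc]
    _ = t'.val * (s.val * e * k) := by rw [idem_comm hki hei]; simp only [mul_assoc]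
    _ = t'.val * s'.val * (k * e) := by rw [h, idem_comm hki hei]; simp only [mul_assoc]

theorem PreHom.inv_congr {ξ η : TightFilter S} {s t : PreHom ξ η} (hs : s ≈ t) :
    s.inv ≈ t.inv := by
  obtain ⟨e, he, h⟩ := hs
  have hei := ξ.isFilter.idem e he
  have h2 : e * star s.val = e * star t.val := by
    have := congrArg star h
    rwa [star_mul, star_mul, star_idem hei] at this
  refine ⟨s.val * e * star s.val, by rw [← s.act_eq]; exact conj_mem_actSet _ ξ.isFilter he, ?_⟩
  change star s.val * (s.val * e * star s.val) = star t.val * (s.val * e * star s.val)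
  have key : ∀ r : S, star r * (r * e * star r) = e * star r := fun r => by
    calc star r * (r * e * star r) = star r * r * e * star r := by simp only [mul_assoc]
      _ = e * (star r * r) * star r := by rw [idem_comm (idem_star_mul r) hei]
      _ = e * (star r * star (star r) * star r) := by simp only [mul_assoc, star_star]
      _ = e * star r := by rw [mul_star_mul]
  rw [key, h, mul_assoc, h2]
  rw [← mul_assoc t.val, key]

/-- The tight groupoid of `S`: the groupoid of germs of the action of `S` on its space of tight
filters.  Its objects (units) are the tight filters, an arrow `ξ ⟶ η` is a germ `[s, ξ]` with source
`ξ` and range `s · ξ = η`; the composite `[s, ξ] ≫ [t, s · ξ]` is `[t s, ξ]`, the unit at `ξ` is the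
germ `[e, ξ]` of any `e ∈ ξ`, and the inverse of `[s, ξ]` is `[s*, s · ξ]`. -/
noncomputable instance tightGroupoid : Groupoid (TightFilter S) where
  Hom := Germ
  id ξ := Quotient.mk _ (PreHom.one ξ)
  comp p q := Quotient.map₂ PreHom.comp (fun _ _ hs _ _ ht => PreHom.comp_congr hs ht) p q
  inv p := Quotient.map PreHom.inv (fun _ _ hs => PreHom.inv_congr hs) p
  id_comp {ξ η} p := by
    induction p using Quotient.inductionOn with
    | _ s =>
      refine Quotient.sound ⟨_, ξ.isFilter.nonempty.some_mem, ?_⟩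
      change s.val * _ * _ = s.val * _
      rw [mul_assoc]
      congr 1
      exact ξ.isFilter.idem _ ξ.isFilter.nonempty.some_mem
  comp_id {ξ η} p := by
    induction p using Quotient.inductionOn with
    | _ s =>
      have he := η.isFilter.nonempty.some_mem
      set e := η.isFilter.nonempty.some with hedef
      have he' := he
      rw [← s.act_eq] at he'
      obtain ⟨hi, f, hf, h⟩ := he'
      have hfi := ξ.isFilter.idem f hf
      refine Quotient.sound ⟨f, hf, ?_⟩
      change e * s.val * f = s.val * f
      rw [mul_assoc, ← conj_mul s.val hfi, ← mul_assoc e, idem_comm hi (idem_conj s.val hfi), h]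
  assoc {_ _ _ _} p q r := by
    induction p using Quotient.inductionOn with
    | _ s =>
    induction q using Quotient.inductionOn with
    | _ t =>
    induction r using Quotient.inductionOn with
    | _ k =>
      refine congrArg (Quotient.mk _) (PreHom.ext ?_)
      change k.val * (t.val * s.val) = k.val * t.val * s.val
      rw [mul_assoc]
  inv_comp {ξ η} p := by
    induction p using Quotient.inductionOn with
    | _ s =>
      have he := η.isFilter.nonempty.some_mem
      have hsi := η.isFilter.idem _ s.range_mem
      have hei := η.isFilter.idem _ he
      refine Quotient.sound ⟨_, η.isFilter.mul_mem _ s.range_mem _ he, ?_⟩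
      change s.val * star s.val * (s.val * star s.val * η.isFilter.nonempty.some) =
        η.isFilter.nonempty.some * (s.val * star s.val * η.isFilter.nonempty.some)
      rw [← mul_assoc, hsi, idem_comm hsi hei]
      simp only [← mul_assoc, hei]
  comp_inv {ξ η} p := by
    induction p using Quotient.inductionOn with
    | _ s =>
      have he := ξ.isFilter.nonempty.some_mem
      have hsi := ξ.isFilter.idem _ s.dom
      have hei := ξ.isFilter.idem _ he
      refine Quotient.sound ⟨_, ξ.isFilter.mul_mem _ s.dom _ he, ?_⟩
      change star s.val * s.val * (star s.val * s.val * ξ.isFilter.nonempty.some) =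
        ξ.isFilter.nonempty.some * (star s.val * s.val * ξ.isFilter.nonempty.some)
      rw [← mul_assoc, hsi, idem_comm hsi hei]
      simp only [← mul_assoc, hei]

/-- The germ `[s, ξ]`, as an arrow of the tight groupoid. -/
def germ {ξ η : TightFilter S} (s : S) (hs : star s * s ∈ ξ.carrier)
    (h : actSet s ξ.carrier = η.carrier) : ξ ⟶ η :=
  Quotient.mk (germSetoid ξ η) ⟨s, hs, h⟩

end InverseSemigroup₀

/-! ### Principal groupoids -/

/-- The isotropy bundle of a groupoid: all arrows whose source and range coincide. -/
def isotropyBundle (G : Type u) [Groupoid.{v} G] : Set (Σ x y : G, x ⟶ y) :=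
  {γ | γ.1 = γ.2.1}

/-- The unit space of a groupoid, as a set of arrows. -/
def unitArrows (G : Type u) [Groupoid.{v} G] : Set (Σ x y : G, x ⟶ y) :=
  Set.range fun x : G => ⟨x, x, 𝟙 x⟩

/-- A groupoid is principal if its isotropy bundle is its unit space. -/
def IsPrincipalGroupoid (G : Type u) [Groupoid.{v} G] : Prop :=
  isotropyBundle G = unitArrows G

/-! ### Boolean dynamical systems -/

/-- An action on a (possibly non-unital) Boolean algebra: a homomorphism of Boolean algebras sending
`⊥` to `⊥`. -/
structure IsBooleanAction {B : Type u} [GeneralizedBooleanAlgebra B] (θ : B → B) : Prop where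
  map_bot : θ ⊥ = ⊥
  map_sup : ∀ x y, θ (x ⊔ y) = θ x ⊔ θ y
  map_inf : ∀ x y, θ (x ⊓ y) = θ x ⊓ θ y
  map_sdiff : ∀ x y, θ (x \ y) = θ x \ θ y

/-- The composite `θ_{α_n} ∘ ⋯ ∘ θ_{α_1}` for a word `α = α_1 ⋯ α_n` (the identity for the empty
word). -/
def wordAct {B : Type u} {L : Type v} (θ : L → B → B) (α : List L) (A : B) : B :=
  α.foldl (fun X a => θ a X) A

/-- A Boolean dynamical system `(B, L, θ)`: every `θ_α` with `α` a nonempty word has compact range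
(a least upper bound `R_α` of all `θ_α(A)` exists) and closed domain (`θ_α(D_α) = R_α` for some
`D_α`). -/
structure BooleanDynamicalSystem (B : Type u) [GeneralizedBooleanAlgebra B] (L : Type v) where
  θ : L → B → B
  isAction : ∀ a, IsBooleanAction (θ a)
  compactRange : ∀ α : List L, α ≠ [] → ∃ R, IsLUB (Set.range (wordAct θ α)) R
  closedDomain : ∀ α : List L, α ≠ [] → ∃ D, IsLUB (Set.range (wordAct θ α)) (wordAct θ α D)

namespace BooleanDynamicalSystem

open InverseSemigroup₀

variable {B : Type u} [GeneralizedBooleanAlgebra B] {L : Type v} (D : BooleanDynamicalSystem B L)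

/-- The range `R_α` of `θ_α`, for a nonempty word `α`. -/
noncomputable def R (α : List L) (h : α ≠ []) : B := (D.compactRange α h).choose

/-- The range `R_α` of an arbitrary word, in `B` with a formal largest element adjoined; for the
empty word it is this formal largest element. -/
noncomputable def Rng : List L → WithTop B
  | [] => ⊤
  | a :: α => (D.R (a :: α) (List.cons_ne_nil a α) : B)

/-- `Δ_A = {a : θ_a(A) ≠ ∅}`. -/
def Δ (A : B) : Set L := {a | D.θ a A ≠ ⊥}

/-- Regular sets: `0 < |Δ_X| < ∞` for all `∅ ≠ X ⊆ A` (so `∅` is regular). -/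
def IsRegular (A : B) : Prop :=
  ∀ X, X ≠ ⊥ → X ≤ A → (D.Δ X).Nonempty ∧ (D.Δ X).Finite

/-- Cuntz-Krieger representations of a Boolean dynamical system in a C*-algebra `C`.  In the last
condition the index set is finite. -/
structure IsCKRep {C : Type w} [NonUnitalCStarAlgebra C] (P : B → C) (S : L → C) : Prop where
  projection : ∀ A, IsStarProjection (P A)
  partial_isometry : ∀ a, S a * star (S a) * S a = S a
  bot : P ⊥ = 0
  inf : ∀ A A', P A * P A' = P (A ⊓ A')
  sup : ∀ A A', P (A ⊔ A') = P A + P A' - P (A ⊓ A')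
  comm : ∀ a A, P A * S a = S a * P (D.θ a A)
  star_mul_self : ∀ a, star (S a) * S a = P (D.R [a] (List.cons_ne_nil a []))
  star_mul_of_ne : ∀ a b, a ≠ b → star (S a) * S b = 0
  regular : ∀ A, D.IsRegular A →
    P A = ∑ᶠ (a : L) (_ : a ∈ D.Δ A), S a * P (D.θ a A) * star (S a)

/-- A Cuntz-Krieger representation in some C*-algebra.  Every Cuntz-Krieger representation generates
a C*-algebra which is, up to isomorphism, in this universe. -/
structure CKRep where
  C : Type (max u v)
  [inst : NonUnitalCStarAlgebra C]
  P : B → C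
  S : L → C
  isRep : D.IsCKRep P S

attribute [instance] CKRep.inst

section rep

variable {D}
variable {C : Type w} [NonUnitalCStarAlgebra C] {P : B → C} {S : L → C}

theorem IsCKRep.norm_P_le (h : D.IsCKRep P S) (A : B) : ‖P A‖ ≤ 1 := by
  have h1 := CStarRing.norm_star_mul_self (x := P A)
  rw [(h.projection A).isSelfAdjoint.star_eq, (h.projection A).isIdempotentElem.eq] at h1
  nlinarith [norm_nonneg (P A)]

theorem IsCKRep.norm_S_le (h : D.IsCKRep P S) (a : L) : ‖S a‖ ≤ 1 := by
  have h1 := CStarRing.norm_star_mul_self (x := S a)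
  rw [h.star_mul_self] at h1
  have := h.norm_P_le (D.R [a] (List.cons_ne_nil a []))
  nlinarith [norm_nonneg (S a)]

end rep

/-- The product (of bounded families) of all Cuntz-Krieger representations. -/
abbrev BigProd : Type (max u v + 1) := lp (fun i : D.CKRep => i.C) ⊤

noncomputable def bigP (A : B) : D.BigProd :=
  ⟨fun i => i.P A, memℓp_infty ⟨1, by rintro _ ⟨i, rfl⟩; exact i.isRep.norm_P_le A⟩⟩

noncomputable def bigS (a : L) : D.BigProd :=
  ⟨fun i => i.S a, memℓp_infty ⟨1, by rintro _ ⟨i, rfl⟩; exact i.isRep.norm_S_le a⟩⟩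

/-- The closed star-subalgebra generated by the product of all Cuntz-Krieger representations. -/
noncomputable def universalSubalgebra : NonUnitalStarSubalgebra ℂ D.BigProd :=
  (NonUnitalStarAlgebra.adjoin ℂ (Set.range D.bigP ∪ Set.range D.bigS)).topologicalClosure

/-- The C*-algebra `C*(B, L, θ)` of the Boolean dynamical system, generated by the universal
Cuntz-Krieger representation (see `isCKRep_universal` and `exists_hom` below). -/
abbrev CStar : Type (max u v + 1) := D.universalSubalgebra

noncomputable instance : NonUnitalCStarAlgebra D.CStar :=
  NonUnitalStarSubalgebra.nonUnitalCStarAlgebra _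
    (h_closed := NonUnitalStarSubalgebra.isClosed_topologicalClosure _)

/-- The universal projections `p_A`. -/
noncomputable def p (A : B) : D.CStar :=
  ⟨D.bigP A, NonUnitalStarSubalgebra.le_topologicalClosure _
    (NonUnitalStarAlgebra.subset_adjoin ℂ _ (Or.inl ⟨A, rfl⟩))⟩

/-- The universal partial isometries `s_a`. -/
noncomputable def s (a : L) : D.CStar :=
  ⟨D.bigS a, NonUnitalStarSubalgebra.le_topologicalClosure _
    (NonUnitalStarAlgebra.subset_adjoin ℂ _ (Or.inr ⟨a, rfl⟩))⟩

/-- The component of an element of `C*(B, L, θ)` in a given representation. -/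
noncomputable def ev (i : D.CKRep) : D.CStar →⋆ₙₐ[ℂ] i.C where
  toFun x := x.1 i
  map_smul' _ _ := rfl
  map_zero' := rfl
  map_add' _ _ := rfl
  map_mul' _ _ := rfl
  map_star' _ := rfl

theorem ext_ev {x y : D.CStar} (h : ∀ i, D.ev i x = D.ev i y) : x = y :=
  Subtype.ext (lp.ext (funext h))

@[simp] theorem ev_p (i : D.CKRep) (A : B) : D.ev i (D.p A) = i.P A := rfl
@[simp] theorem ev_s (i : D.CKRep) (a : L) : D.ev i (D.s a) = i.S a := rfl

/-- `p`, `s` is a Cuntz-Krieger representation. -/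
theorem isCKRep_universal : D.IsCKRep D.p D.s where
  projection A := by
    refine ⟨D.ext_ev fun i => ?_, D.ext_ev fun i => ?_⟩
    · simpa using (i.isRep.projection A).isIdempotentElem.eq
    · simpa [map_star] using (i.isRep.projection A).isSelfAdjoint.star_eq
  partial_isometry a := D.ext_ev fun i => by
    simpa [map_star] using i.isRep.partial_isometry a
  bot := D.ext_ev fun i => by simpa using i.isRep.bot
  inf A A' := D.ext_ev fun i => by simpa using i.isRep.inf A A'
  sup A A' := D.ext_ev fun i => by simpa using i.isRep.sup A A'
  comm a A := D.ext_ev fun i => by simpa using i.isRep.comm a A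
  star_mul_self a := D.ext_ev fun i => by simpa [map_star] using i.isRep.star_mul_self a
  star_mul_of_ne a b h := D.ext_ev fun i => by
    simpa [map_star] using i.isRep.star_mul_of_ne a b h
  regular A hA := D.ext_ev fun i => by
    have hfin : (D.Δ A).Finite := by
      by_cases h : A = ⊥
      · have : D.Δ A = ∅ := by
          ext a; simp [Δ, h, (D.isAction a).map_bot]
        rw [this]; exact Set.finite_empty
      · exact (hA A h le_rfl).2
    rw [ev_p, i.isRep.regular A hA, finsum_mem_eq_finite_toFinset_sum _ hfin,
      finsum_mem_eq_finite_toFinset_sum _ hfin, map_sum]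
    simp [map_star]

/-- The universal property of `p`, `s`. -/
theorem exists_hom {C : Type (max u v)} [NonUnitalCStarAlgebra C] {P : B → C} {S : L → C}
    (h : D.IsCKRep P S) :
    ∃ π : D.CStar →⋆ₙₐ[ℂ] C, (∀ A, π (D.p A) = P A) ∧ ∀ a, π (D.s a) = S a :=
  ⟨D.ev ⟨C, P, S, h⟩, fun _ => rfl, fun _ => rfl⟩

/-! ### The inverse semigroup `T` -/

/-- Left multiplication by `s_α = s_{α_1} ⋯ s_{α_n}` (the identity for the empty word). -/
noncomputable def sMul (α : List L) (x : D.CStar) : D.CStar :=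
  α.foldr (fun a y => D.s a * y) x

/-- The element `s_α p_A s_β^* = (s_α p_A) (s_β p_A)^*` of `C*(B, L, θ)`. -/
noncomputable def elt (α : List L) (A : B) (β : List L) : D.CStar :=
  D.sMul α (D.p A) * star (D.sMul β (D.p A))

/-- The set `T = {s_α p_A s_β^* : A ⊆ R_α ∩ R_β ≠ ∅} ∪ {0}`. -/
def TSet : Set D.CStar :=
  {x | ∃ (α : List L) (A : B) (β : List L), (A : WithTop B) ≤ D.Rng α ⊓ D.Rng β ∧
    D.Rng α ⊓ D.Rng β ≠ ⊥ ∧ x = D.elt α A β} ∪ {0}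

section lemmas

variable {D}

theorem wordAct_inf (α : List L) (A A' : B) :
    wordAct D.θ α (A ⊓ A') = wordAct D.θ α A ⊓ wordAct D.θ α A' := by
  induction α generalizing A A' with
  | nil => rfl
  | cons a α ih =>
    change wordAct D.θ α (D.θ a (A ⊓ A')) = _
    rw [(D.isAction a).map_inf, ih]; rfl

theorem wordAct_mono (α : List L) {A A' : B} (h : A ≤ A') :
    wordAct D.θ α A ≤ wordAct D.θ α A' := by
  rw [← inf_eq_left, ← wordAct_inf, inf_eq_left.2 h]

theorem wordAct_le_R (α : List L) (h : α ≠ []) (A : B) : wordAct D.θ α A ≤ D.R α h :=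
  (D.compactRange α h).choose_spec.1 ⟨A, rfl⟩

theorem exists_R_eq (α : List L) (h : α ≠ []) : ∃ X, D.R α h = wordAct D.θ α X := by
  obtain ⟨X, hX⟩ := D.closedDomain α h
  exact ⟨X, (D.compactRange α h).choose_spec.unique hX⟩

theorem R_cons (a : L) (α : List L) :
    D.R (a :: α) (List.cons_ne_nil a α) = wordAct D.θ α (D.R [a] (List.cons_ne_nil a [])) := by
  apply le_antisymm
  · obtain ⟨X, hX⟩ := exists_R_eq (D := D) (a :: α) (List.cons_ne_nil a α)
    rw [hX]
    exact wordAct_mono α (wordAct_le_R [a] (List.cons_ne_nil a []) X)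
  · obtain ⟨X, hX⟩ := exists_R_eq (D := D) [a] (List.cons_ne_nil a [])
    rw [hX]
    exact wordAct_le_R (a :: α) (List.cons_ne_nil a α) X

theorem wordAct_R_le_Rng (a : L) (α : List L) :
    ((wordAct D.θ α (D.R [a] (List.cons_ne_nil a [])) : B) : WithTop B) ≤ D.Rng α := by
  cases α with
  | nil => exact le_top
  | cons b α => exact WithTop.coe_le_coe.2 (wordAct_le_R _ _ _)

theorem sMul_cons (a : L) (α : List L) (x : D.CStar) :
    D.sMul (a :: α) x = D.s a * D.sMul α x := rfl

theorem sMul_append (α β : List L) (x : D.CStar) :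
    D.sMul (α ++ β) x = D.sMul α (D.sMul β x) := by
  simp [sMul]

theorem sMul_mul (α : List L) (x y : D.CStar) : D.sMul α x * y = D.sMul α (x * y) := by
  induction α with
  | nil => rfl
  | cons a α ih => rw [sMul_cons, mul_assoc, ih, sMul_cons]

theorem star_p (A : B) : star (D.p A) = D.p A := (D.isCKRep_universal.projection A).isSelfAdjoint

theorem p_mul (A A' : B) : D.p A * D.p A' = D.p (A ⊓ A') := D.isCKRep_universal.inf A A'

theorem p_mul_sMul (A : B) (α : List L) (x : D.CStar) :
    D.p A * D.sMul α x = D.sMul α (D.p (wordAct D.θ α A) * x) := by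
  induction α generalizing A with
  | nil => rfl
  | cons a α ih =>
    rw [sMul_cons, ← mul_assoc, D.isCKRep_universal.comm, mul_assoc, ih]; rfl

theorem s_eq (a : L) : D.s a = D.s a * D.p (D.R [a] (List.cons_ne_nil a [])) := by
  rw [← D.isCKRep_universal.star_mul_self, ← mul_assoc, D.isCKRep_universal.partial_isometry]

/-- `s_α p_A` only depends on the part of `A` below `R_α`. -/
theorem exists_sMul_eq (α : List L) : ∃ f : B → B, ∀ A, f A ≤ A ∧ ((f A : B) : WithTop B) ≤ D.Rng α ∧
    ∀ A', A' ≤ A → D.sMul α (D.p A') = D.sMul α (D.p (A' ⊓ f A)) := by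
  cases α with
  | nil => exact ⟨id, fun A => ⟨le_rfl, le_top, fun A' h => by rw [id, inf_eq_left.2 h]⟩⟩
  | cons a α =>
    refine ⟨fun A => D.R (a :: α) (List.cons_ne_nil a α) ⊓ A,
      fun A => ⟨inf_le_right, WithTop.coe_le_coe.2 inf_le_left, fun A' h => ?_⟩⟩
    have key : ∀ X, D.sMul (a :: α) (D.p X) =
        D.sMul (a :: α) (D.p (D.R (a :: α) (List.cons_ne_nil a α) ⊓ X)) := fun X => by
      conv_lhs => rw [sMul_cons, s_eq, mul_assoc, p_mul_sMul, p_mul, ← R_cons]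
      rfl
    change _ = D.sMul (a :: α) (D.p (A' ⊓ (_ ⊓ A)))
    rw [key A', inf_left_comm A', inf_eq_left.2 h]

theorem sMul_mul_star_sMul (α β : List L) (A A' : B) :
    D.sMul α (D.p A) * star (D.sMul β (D.p A')) = D.elt α (A ⊓ A') β := by
  have H : ∀ X Y, D.sMul α (D.p X) * star (D.sMul β (D.p Y)) =
      D.sMul α (star (D.sMul β (D.p (Y ⊓ X)))) := fun X Y => by
    rw [sMul_mul, ← star_p X, ← star_mul, sMul_mul, p_mul]
  rw [elt, H, H, inf_idem, inf_comm]

theorem elt_mem (α : List L) (A : B) (β : List L) : D.elt α A β ∈ D.TSet := by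
  obtain ⟨f, hf⟩ := exists_sMul_eq (D := D) α
  obtain ⟨g, hg⟩ := exists_sMul_eq (D := D) β
  have h : D.elt α A β = D.elt α (f A ⊓ g A) β := by
    rw [elt, (hf A).2.2 A le_rfl, (hg A).2.2 A le_rfl, sMul_mul_star_sMul,
      inf_eq_right.2 (hf A).1, inf_eq_right.2 (hg A).1]
  rw [h]
  by_cases h0 : f A ⊓ g A = ⊥
  · right
    rw [h0, elt, D.isCKRep_universal.bot]
    have : D.sMul α 0 = 0 := by
      have := sMul_mul (D := D) α 0 0
      rwa [mul_zero, mul_zero, eq_comm] at this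
    rw [this, zero_mul]; rfl
  · left
    have hle : ((f A ⊓ g A : B) : WithTop B) ≤ D.Rng α ⊓ D.Rng β :=
      le_inf ((WithTop.coe_le_coe.2 inf_le_left).trans (hf A).2.1)
        ((WithTop.coe_le_coe.2 inf_le_right).trans (hg A).2.1)
    refine ⟨α, _, β, hle, fun hb => h0 ?_, rfl⟩
    rw [hb] at hle
    exact WithTop.coe_injective (le_bot_iff.1 hle)

theorem mem_TSet_iff {x : D.CStar} : x ∈ D.TSet ↔ ∃ (α : List L) (A : B) (β : List L), x = D.elt α A β := by
  constructor
  · rintro (⟨α, A, β, -, -, h⟩ | h)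
    · exact ⟨α, A, β, h⟩
    · refine ⟨[], ⊥, [], ?_⟩
      rw [Set.mem_singleton_iff.1 h, elt]
      change 0 = D.p ⊥ * star (D.p ⊥)
      rw [D.isCKRep_universal.bot, zero_mul]
  · rintro ⟨α, A, β, rfl⟩
    exact elt_mem α A β

/-- The products `(s_α p_A)^* (s_β p_A')`. -/
theorem star_sMul_mul (α β : List L) (A A' : B) :
    (∃ ε X, β = α ++ ε ∧ star (D.sMul α (D.p A)) * D.sMul β (D.p A') = D.sMul ε (D.p X)) ∨
    (∃ ε X, α = β ++ ε ∧ star (D.sMul α (D.p A)) * D.sMul β (D.p A') = star (D.sMul ε (D.p X))) ∨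
    star (D.sMul α (D.p A)) * D.sMul β (D.p A') = 0 := by
  induction α generalizing β A' with
  | nil =>
    left
    refine ⟨β, wordAct D.θ β A ⊓ A', rfl, ?_⟩
    change star (D.p A) * _ = _
    rw [star_p, p_mul_sMul, p_mul]
  | cons a α ih =>
    cases β with
    | nil =>
      right; left
      refine ⟨a :: α, wordAct D.θ (a :: α) A' ⊓ A, rfl, ?_⟩
      change _ * D.p A' = _
      rw [← p_mul, ← p_mul_sMul, star_mul, star_p]
    | cons b β =>
      have e : star (D.sMul (a :: α) (D.p A)) * D.sMul (b :: β) (D.p A') =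
          star (D.sMul α (D.p A)) * ((star (D.s a) * D.s b) * D.sMul β (D.p A')) := by
        rw [sMul_cons, sMul_cons, star_mul]; simp only [mul_assoc]
      by_cases hab : a = b
      · subst hab
        rw [D.isCKRep_universal.star_mul_self, p_mul_sMul, p_mul] at e
        rw [e]
        rcases ih β (wordAct D.θ β (D.R [a] (List.cons_ne_nil a [])) ⊓ A') with
          ⟨ε, X, h, h'⟩ | ⟨ε, X, h, h'⟩ | h'
        · exact Or.inl ⟨ε, X, by rw [h]; rfl, h'⟩
        · exact Or.inr (Or.inl ⟨ε, X, by rw [h]; rfl, h'⟩)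
        · exact Or.inr (Or.inr h')
      · right; right
        rw [e, D.isCKRep_universal.star_mul_of_ne a b hab, zero_mul, mul_zero]

theorem star_sMul_mul_self (α : List L) (A : B) (h : (A : WithTop B) ≤ D.Rng α) :
    star (D.sMul α (D.p A)) * D.sMul α (D.p A) = D.p A := by
  induction α with
  | nil =>
    change star (D.p A) * D.p A = _
    rw [star_p, p_mul, inf_idem]
  | cons a α ih =>
    have h1 : A ≤ wordAct D.θ α (D.R [a] (List.cons_ne_nil a [])) := by
      rw [← R_cons]; exact WithTop.coe_le_coe.1 h
    rw [sMul_cons, star_mul, mul_assoc, ← mul_assoc (star (D.s a)),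
      D.isCKRep_universal.star_mul_self, p_mul_sMul, p_mul, inf_eq_right.2 h1]
    exact ih ((WithTop.coe_le_coe.2 h1).trans (wordAct_R_le_Rng a α))

theorem star_elt (α : List L) (A : B) (β : List L) : star (D.elt α A β) = D.elt β A α := by
  rw [elt, elt, star_mul, star_star]

theorem star_mem_TSet {x : D.CStar} (hx : x ∈ D.TSet) : star x ∈ D.TSet := by
  obtain ⟨α, A, β, rfl⟩ := mem_TSet_iff.1 hx
  rw [star_elt]; exact elt_mem _ _ _

theorem elt_mul_elt (α β γ δ : List L) (A A' : B) :
    (∃ ε X, γ = β ++ ε ∧ D.elt α A β * D.elt γ A' δ = D.elt (α ++ ε) X δ) ∨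
    (∃ ε X, β = γ ++ ε ∧ D.elt α A β * D.elt γ A' δ = D.elt α X (δ ++ ε)) ∨
    D.elt α A β * D.elt γ A' δ = 0 := by
  have e : D.elt α A β * D.elt γ A' δ = D.sMul α (D.p A) *
      (star (D.sMul β (D.p A)) * D.sMul γ (D.p A')) * star (D.sMul δ (D.p A')) := by
    rw [elt, elt]; simp only [mul_assoc]
  rcases star_sMul_mul (D := D) β γ A A' with ⟨ε, X, h, h'⟩ | ⟨ε, X, h, h'⟩ | h'
  · left
    exact ⟨ε, wordAct D.θ ε A ⊓ X ⊓ A', h, by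
      rw [e, h', sMul_mul α, p_mul_sMul, ← sMul_append, p_mul, sMul_mul_star_sMul]⟩
  · right; left
    exact ⟨ε, A ⊓ (wordAct D.θ ε A' ⊓ X), h, by
      rw [e, h', mul_assoc, ← star_mul, sMul_mul δ, p_mul_sMul, ← sMul_append, p_mul,
        sMul_mul_star_sMul]⟩
  · right; right
    rw [e, h', mul_zero, zero_mul]

theorem mul_mem_TSet {x y : D.CStar} (hx : x ∈ D.TSet) (hy : y ∈ D.TSet) : x * y ∈ D.TSet := by
  obtain ⟨α, A, β, rfl⟩ := mem_TSet_iff.1 hx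
  obtain ⟨γ, A', δ, rfl⟩ := mem_TSet_iff.1 hy
  rcases elt_mul_elt (D := D) α β γ δ A A' with ⟨ε, X, -, h⟩ | ⟨ε, X, -, h⟩ | h <;> rw [h]
  · exact elt_mem _ _ _
  · exact elt_mem _ _ _
  · exact Or.inr rfl

theorem elt_mul_star (α β : List L) (A : B) : ∃ X, D.elt α A β * star (D.elt α A β) = D.elt α X α := by
  rw [star_elt]
  have h0 : D.elt α ⊥ α = 0 := by
    rw [elt, D.isCKRep_universal.bot]
    have : D.sMul α 0 = 0 := by
      have := sMul_mul (D := D) α 0 0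
      rwa [mul_zero, mul_zero, eq_comm] at this
    rw [this, zero_mul]
  rcases elt_mul_elt (D := D) α β β α A A with ⟨ε, X, h, h'⟩ | ⟨ε, X, h, h'⟩ | h'
  · obtain rfl : ε = [] := List.self_eq_append_right.1 h
    rw [List.append_nil] at h'; exact ⟨X, h'⟩
  · obtain rfl : ε = [] := List.self_eq_append_right.1 h
    rw [List.append_nil] at h'; exact ⟨X, h'⟩
  · exact ⟨⊥, by rw [h', h0]⟩

theorem elt_comm (α β : List L) (A A' : B) :
    D.elt α A α * D.elt β A' β = D.elt β A' β * D.elt α A α := by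
  have key : star (D.elt α A α * D.elt β A' β) = D.elt α A α * D.elt β A' β := by
    rcases elt_mul_elt (D := D) α α β β A A' with ⟨ε, X, h, h'⟩ | ⟨ε, X, h, h'⟩ | h'
    · rw [h', star_elt, ← h]
    · rw [h', star_elt, ← h]
    · rw [h', star_zero]
  rw [star_mul, star_elt, star_elt] at key
  exact key.symm

end lemmas

/-- `T` as a type. -/
abbrev T : Type (max u v + 1) := D.TSet

/-- `T` is an inverse semigroup under the multiplication and involution of `C*(B, L, θ)`. -/
noncomputable instance : InverseSemigroup₀ D.T where
  mul x y := ⟨x.1 * y.1, mul_mem_TSet x.2 y.2⟩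
  mul_assoc x y z := Subtype.ext (mul_assoc x.1 y.1 z.1)
  zero := ⟨0, Or.inr rfl⟩
  zero_mul x := Subtype.ext (zero_mul x.1)
  mul_zero x := Subtype.ext (mul_zero x.1)
  star x := ⟨star x.1, star_mem_TSet x.2⟩
  star_involutive x := Subtype.ext (star_star x.1)
  star_mul x y := Subtype.ext (star_mul x.1 y.1)
  mul_star_mul x := by
    apply Subtype.ext
    change x.1 * star x.1 * x.1 = x.1
    rcases x.2 with ⟨α, A, β, h, -, hx⟩ | hx
    · have h2 : (A : WithTop B) ≤ D.Rng β := h.trans inf_le_right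
      have h1 : (A : WithTop B) ≤ D.Rng α := h.trans inf_le_left
      rw [hx, star_elt, elt, elt]
      calc D.sMul α (D.p A) * star (D.sMul β (D.p A)) * (D.sMul β (D.p A) * star (D.sMul α (D.p A))) *
            (D.sMul α (D.p A) * star (D.sMul β (D.p A)))
          = D.sMul α (D.p A) * (star (D.sMul β (D.p A)) * D.sMul β (D.p A)) *
            (star (D.sMul α (D.p A)) * D.sMul α (D.p A)) * star (D.sMul β (D.p A)) := by
              simp only [mul_assoc]
        _ = _ := by
              rw [star_sMul_mul_self β A h2, star_sMul_mul_self α A h1, sMul_mul, sMul_mul, p_mul,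
                p_mul, inf_idem, inf_idem]
    · rw [Set.mem_singleton_iff.1 hx, mul_zero]
  comm_proj x y := by
    apply Subtype.ext
    change x.1 * star x.1 * (y.1 * star y.1) = y.1 * star y.1 * (x.1 * star x.1)
    obtain ⟨α, A, β, hx⟩ := mem_TSet_iff.1 x.2
    obtain ⟨γ, A', δ, hy⟩ := mem_TSet_iff.1 y.2
    obtain ⟨X, hX⟩ := elt_mul_star (D := D) α β A
    obtain ⟨Y, hY⟩ := elt_mul_star (D := D) γ δ A'
    rw [hx, hy, hX, hY, elt_comm]

/-- The tight groupoid `𝒢_tight(T)`; its unit space is the space of tight filters of `T`. -/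
abbrev Gtight : Type (max u v + 1) := TightFilter D.T

/-! ### The cocycle `c` -/

section gauge

variable {D}

/-- The representation `P`, `z S`, for `z` in the unit circle. -/
noncomputable def CKRep.twist (i : D.CKRep) (z : Circle) : D.CKRep where
  C := i.C
  P := i.P
  S a := (z : ℂ) • i.S a
  isRep :=
    have hz : (z : ℂ) * star (z : ℂ) = 1 := by
      rw [Complex.star_def, Complex.mul_conj, Circle.normSq_coe]; simp
    have hz' : star (z : ℂ) * (z : ℂ) = 1 := by rw [mul_comm, hz]
    { projection := i.isRep.projection
      partial_isometry := fun a => by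
        simp only [star_smul, smul_mul_assoc, mul_smul_comm, smul_smul]
        rw [hz', mul_one, i.isRep.partial_isometry]
      bot := i.isRep.bot
      inf := i.isRep.inf
      sup := i.isRep.sup
      comm := fun a A => by
        simp only [smul_mul_assoc, mul_smul_comm, i.isRep.comm]
      star_mul_self := fun a => by
        simp only [star_smul, smul_mul_assoc, mul_smul_comm, smul_smul]
        rw [hz, one_smul, i.isRep.star_mul_self]
      star_mul_of_ne := fun a b h => by
        simp only [star_smul, smul_mul_assoc, mul_smul_comm, i.isRep.star_mul_of_ne a b h, smul_zero]
      regular := fun A hA => by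
        rw [i.isRep.regular A hA]
        refine finsum_congr fun a => finsum_congr fun _ => ?_
        simp only [star_smul, smul_mul_assoc, mul_smul_comm, smul_smul]
        first
        | rw [hz, one_smul]
        | rw [hz', one_smul] }

/-- The component of an element of `C*(B, L, θ)` in the twisted representation. -/
noncomputable def evTwist (i : D.CKRep) (z : Circle) : D.CStar →⋆ₙₐ[ℂ] i.C := D.ev (i.twist z)

/-- `x` is homogeneous of degree `n` for the gauge action. -/
def Homog (n : ℤ) (x : D.CStar) : Prop :=
  ∀ (z : Circle) (i : D.CKRep), evTwist i z x = ((z : ℂ) ^ n) • D.ev i x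

theorem Homog.mul {n m : ℤ} {x y : D.CStar} (hx : Homog n x) (hy : Homog m y) :
    Homog (n + m) (x * y) := by
  intro z i
  rw [map_mul, hx, hy, map_mul, smul_mul_assoc, mul_smul_comm, smul_smul, zpow_add₀ (Circle.coe_ne_zero z)]

theorem Homog.star {n : ℤ} {x : D.CStar} (hx : Homog n x) : Homog (-n) (star x) := by
  intro z i
  rw [map_star, hx, star_smul, map_star]
  congr 1
  rw [star_zpow₀, Complex.star_def, ← Circle.coe_inv_eq_conj, Circle.coe_inv, inv_zpow, zpow_neg]

theorem homog_p (A : B) : Homog (D := D) 0 (D.p A) := fun z i => by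
  rw [zpow_zero, one_smul]; rfl

theorem homog_s (a : L) : Homog (D := D) 1 (D.s a) := fun z i => by
  rw [zpow_one]; rfl

theorem homog_sMul (α : List L) {n : ℤ} {x : D.CStar} (hx : Homog n x) :
    Homog (α.length + n) (D.sMul α x) := by
  induction α with
  | nil => rw [List.length_nil, Nat.cast_zero, zero_add]; exact hx
  | cons a α ih =>
    have := (homog_s a).mul ih
    rw [List.length_cons, Nat.cast_succ, show ((α.length : ℤ) + 1 + n) = 1 + (α.length + n) by ring]
    exact this

theorem homog_elt (α : List L) (A : B) (β : List L) :
    Homog ((α.length : ℤ) - β.length) (D.elt α A β) := by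
  have := (homog_sMul α (homog_p (D := D) A)).mul (homog_sMul β (homog_p A)).star
  rwa [show ((α.length : ℤ) + 0 + -(β.length + 0)) = α.length - β.length by ring] at this

theorem Homog.unique {n m : ℤ} {x : D.CStar} (hn : Homog n x) (hm : Homog m x) (hx : x ≠ 0) :
    n = m := by
  have : ∃ i, D.ev i x ≠ 0 := by
    by_contra! h
    exact hx (D.ext_ev fun i => by rw [h i, map_zero])
  obtain ⟨i, hi⟩ := this
  have h1 : ((Circle.exp 1 : Circle) : ℂ) ^ n = ((Circle.exp 1 : Circle) : ℂ) ^ m := by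
    have := (hn (Circle.exp 1) i).symm.trans (hm (Circle.exp 1) i)
    exact smul_left_injective ℂ hi this
  have h2 : Complex.exp ((n : ℂ) * Complex.I) = Complex.exp ((m : ℂ) * Complex.I) := by
    simpa [Circle.coe_exp, ← Complex.exp_int_mul] using h1
  obtain ⟨k, hk⟩ := Complex.exp_eq_exp_iff_exists_int.1 h2
  have h3 : (n : ℂ) = m + k * (2 * Real.pi) := by
    have hI := Complex.I_ne_zero
    apply mul_right_cancel₀ hI
    rw [hk]; ring
  have h4 : (n : ℝ) = m + k * (2 * Real.pi) := by exact_mod_cast h3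
  by_cases hk0 : k = 0
  · subst hk0
    have : (n : ℝ) = m := by simpa using h4
    exact_mod_cast this
  · exfalso
    apply irrational_pi.ne_rat ((n - m : ℚ) / (2 * k))
    have : (k : ℝ) ≠ 0 := by exact_mod_cast hk0
    push_cast
    field_simp
    linarith

end gauge

section cocycle

variable {D}

/-- The degree `|α| - |β|` of `t = s_α p_A s_β^*`; it is well defined for `t ≠ 0`, see `deg_eq`. -/
noncomputable def deg (t : D.T) : ℤ :=
  let h := mem_TSet_iff.1 t.2
  (h.choose.length : ℤ) - h.choose_spec.choose_spec.choose.length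

theorem homog_deg (t : D.T) : Homog (deg t) t.1 := by
  have h := (mem_TSet_iff.1 t.2).choose_spec.choose_spec.choose_spec
  conv => arg 2; rw [h]
  exact homog_elt _ _ _

theorem deg_eq {t : D.T} (ht : t ≠ 0) {α β : List L} {A : B} (h : t.1 = D.elt α A β) :
    deg t = (α.length : ℤ) - β.length := by
  refine (homog_deg t).unique ?_ fun h0 => ht (Subtype.ext h0)
  rw [h]
  exact homog_elt _ _ _

theorem deg_mul {x y : D.T} (h : x * y ≠ 0) : deg (x * y) = deg x + deg y :=
  (homog_deg _).unique ((homog_deg x).mul (homog_deg y)) fun h0 => h (Subtype.ext h0)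

theorem deg_star {x : D.T} (h : x ≠ 0) : deg (star x) = -deg x :=
  (homog_deg (star x)).unique (homog_deg x).star fun h0 => h (Subtype.ext (star_eq_zero.1 h0))

theorem ne_zero_of_star_mul_mem {ξ : D.Gtight} {t : D.T} (h : star t * t ∈ ξ.carrier) : t ≠ 0 := by
  rintro rfl
  rw [mul_zero] at h
  exact ξ.isFilter.zero_notMem h

/-- The cocycle `c [s_α p_A s_β^*, ξ] = |α| - |β|` on the tight groupoid, see `c_germ`. -/
noncomputable def c {ξ η : D.Gtight} (γ : ξ ⟶ η) : ℤ :=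
  Quotient.lift (s := germSetoid ξ η) (fun t => deg t.val) (by
    rintro s t ⟨e, he, h⟩
    have hne : ∀ r : PreHom ξ η, r.val * e ≠ 0 := fun r h0 => by
      have h1 := ξ.isFilter.mul_mem _ r.dom _ he
      rw [mul_assoc, h0, mul_zero] at h1
      exact ξ.isFilter.zero_notMem h1
    have h2 := deg_mul (hne s)
    rw [h, deg_mul (hne t)] at h2
    exact (add_right_cancel h2).symm) γ

theorem c_germ {ξ η : D.Gtight} (t : D.T) (ht : star t * t ∈ ξ.carrier)
    (h : actSet t ξ.carrier = η.carrier) {α β : List L} {A : B} (hα : t.1 = D.elt α A β) :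
    c (germ t ht h : ξ ⟶ η) = (α.length : ℤ) - β.length :=
  deg_eq (ne_zero_of_star_mul_mem ht) hα

theorem c_comp {ξ η ζ : D.Gtight} (γ : ξ ⟶ η) (δ : η ⟶ ζ) : c (γ ≫ δ) = c γ + c δ := by
  induction γ using Quotient.inductionOn with
  | _ s =>
  induction δ using Quotient.inductionOn with
  | _ t =>
    have h : t.val * s.val ≠ 0 := ne_zero_of_star_mul_mem (s.comp t).dom
    exact (deg_mul h).trans (add_comm _ _)

theorem c_inv {ξ η : D.Gtight} (γ : ξ ⟶ η) : c (Groupoid.inv γ) = -c γ := by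
  induction γ using Quotient.inductionOn with
  | _ s => exact deg_star (ne_zero_of_star_mul_mem s.dom)

end cocycle

/-- The subgroupoid `c⁻¹(0)` of the tight groupoid. -/
noncomputable def cInvZero : Subgroupoid D.Gtight where
  arrows _ _ := {γ | c γ = 0}
  inv {_ _ γ} h := by
    change c _ = 0
    rw [c_inv, show c γ = 0 from h, neg_zero]
  mul {_ _ _ γ} h {δ} h' := by
    change c _ = 0
    rw [c_comp, show c γ = 0 from h, show c δ = 0 from h', add_zero]

/-- `c⁻¹(0)` contains all units. -/
theorem cInvZero_isWide : D.cInvZero.IsWide where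
  wide ξ := by
    change c (𝟙 ξ) = 0
    have := c_comp (𝟙 ξ) (𝟙 ξ)
    rw [Category.comp_id] at this
    omega

end BooleanDynamicalSystem

namespace BooleanDynamicalSystem

open InverseSemigroup₀

variable {B : Type u} [GeneralizedBooleanAlgebra B] {L : Type v} {D : BooleanDynamicalSystem B L}

/-! An isotropy germ at a tight filter `ξ` is represented by some `t = s_α p_A s_β^*` with `t · ξ =
ξ`. Such a germ can be composed with itself, and the composite is represented by `t²`. Hence `(t²)*
t²` belongs to `ξ`; since a filter omits `0`, it follows that `t² ≠ 0`.

On the other hand, `t² = s_α p_A (s_β^* s_α) p_A s_β^*`, and the orthogonality relations `s_a^* s_b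
= 0` for `a ≠ b` kill the middle factor unless one of `α`, `β` is a prefix of the other. In general
a tail `ε` of length `||α| - |β||` is left over, and isotropy of nonzero degree can only come from
such a tail. In degree zero the words have equal length, so `ε` is empty and `α = β`. Then `t = s_α
p_A s_α^*` is a projection, so `t = t* t` lies in `ξ`, and the germ of an idempotent belonging to
`ξ` is the unit at `ξ`.

The comparability of words is `eq_of_elt_mul_self_ne_zero`, resting on the product formula
`elt_mul_elt`. The passage from degree zero to idempotence is `mul_self_of_deg_eq_zero`, the
nonvanishing of the square is `mul_self_ne_zero_of_isotropy`, and `eq_id_of_c_eq_zero` combines the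
last two. -/

/-- The elements `s_α p_A s_α^*` with `A ⊆ R_α` are idempotent. -/
theorem elt_mul_self {α : List L} {A : B} (h : (A : WithTop B) ≤ D.Rng α) :
    D.elt α A α * D.elt α A α = D.elt α A α := by
  calc D.elt α A α * D.elt α A α
      = D.sMul α (D.p A) * (star (D.sMul α (D.p A)) * D.sMul α (D.p A)) *
          star (D.sMul α (D.p A)) := by rw [elt]; simp only [mul_assoc]
    -- The bound `A ⊆ R_α` enters through `star_sMul_mul_self`: it makes `(s_α p_A)^* (s_α p_A)`
    -- equal to `p_A`, so that `s_α p_A` is a partial isometry and `s_α p_A s_α^*` is its range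
    -- projection.
    _ = D.elt α A α := by rw [star_sMul_mul_self α A h, sMul_mul, p_mul, inf_idem, elt]

/-- If `s_α p_A s_β^*` has nonzero square, then `α` and `β` are comparable; having the same length,
they coincide. -/
theorem eq_of_elt_mul_self_ne_zero {α β : List L} {A : B} (h : D.elt α A β * D.elt α A β ≠ 0)
    (hl : α.length = β.length) : α = β := by
  -- The words meeting in the middle of the square are `β` and `α`, so the cases are `α = βε`, `β =
  -- αε` and product zero. Only the relation between the words is kept; the value of the product is
  -- discarded.
  rcases elt_mul_elt (D := D) α β α β A A with ⟨ε, X, hε, -⟩ | ⟨ε, X, hε, -⟩ | h0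
  -- Here `|α| = |β| + |ε|`, so equal lengths leave no room for a tail.
  · have : ε = [] := List.length_eq_zero_iff.1 (by
      have := congrArg List.length hε
      rw [List.length_append] at this
      omega)
    rw [hε, this, List.append_nil]
  · have : ε = [] := List.length_eq_zero_iff.1 (by
      have := congrArg List.length hε
      rw [List.length_append] at this
      omega)
    rw [hε, this, List.append_nil]
  · exact absurd h0 h

/-- An element of `T` of degree zero with nonzero square is idempotent. -/
theorem mul_self_of_deg_eq_zero {t : D.T} (h : t * t ≠ 0) (hd : deg t = 0) : t * t = t := by
  have ht : t ≠ 0 := fun h0 => h (by rw [h0, mul_zero])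
  -- Membership in `TSet` is unpacked directly rather than through `mem_TSet_iff`, which forgets the
  -- bound `A ⊆ R_α ∩ R_β` needed at the end for idempotence.
  rcases t.2 with ⟨α, A, β, hA, -, hx⟩ | h0
  -- The value of `deg` comes from a chosen expression of `t`, possibly different from the one at
  -- hand; since `t ≠ 0`, the gauge action forces both to give the same difference of lengths.
  · rw [deg_eq ht hx] at hd
    have hne : D.elt α A β * D.elt α A β ≠ 0 := fun h0 => h (Subtype.ext (by
      change t.1 * t.1 = 0
      rw [hx, h0]))
    -- The integer equation `|α| - |β| = 0` in `hd` becomes the equality of natural numbers asked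
    -- for.
    obtain rfl := eq_of_elt_mul_self_ne_zero hne (by omega)
    apply Subtype.ext
    change t.1 * t.1 = t.1
    rw [hx, elt_mul_self (hA.trans inf_le_left)]
  · exact absurd (Subtype.ext (Set.mem_singleton_iff.1 h0)) ht

/-- A representative of an isotropy germ has nonzero square. -/
theorem mul_self_ne_zero_of_isotropy {ξ : D.Gtight} (t : PreHom ξ ξ) : t.val * t.val ≠ 0 := by
  intro h
  -- Source and range agree, so `t` composes with itself; the domain condition of the composite puts
  -- `(t²)* t²` in `ξ`, which is impossible if `t² = 0`.
  exact ne_zero_of_star_mul_mem (t.comp t).dom h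

/-- Isotropy germs of degree zero are units. -/
theorem eq_id_of_c_eq_zero {ξ : D.Gtight} (γ : ξ ⟶ ξ) (h : c γ = 0) : γ = 𝟙 ξ := by
  induction γ using Quotient.inductionOn with
  | _ t =>
    -- On the class of `t` the cocycle unfolds to `deg t.val`, so `h` serves as the degree
    -- hypothesis without conversion.
    have hi : t.val * t.val = t.val := mul_self_of_deg_eq_zero (mul_self_ne_zero_of_isotropy t) h
    -- An idempotent is its own adjoint, so the domain projection `t* t` is `t` itself.
    have ht : t.val ∈ ξ.carrier := by
      have := t.dom
      rwa [star_idem hi, hi] at this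
    have he := ξ.isFilter.nonempty.some_mem
    have hei := ξ.isFilter.idem _ he
    -- Let `e` be the chosen element of `ξ` that represents the unit. The germs of `t` and `e` are
    -- compared on `t e ∈ ξ`: as `t` and `e` are commuting idempotents, both `t (t e)` and `e (t e)`
    -- equal `t e`.
    refine Quotient.sound ⟨_, ξ.isFilter.mul_mem _ ht _ he, ?_⟩
    change t.val * (t.val * ξ.isFilter.nonempty.some) =
      ξ.isFilter.nonempty.some * (t.val * ξ.isFilter.nonempty.some)
    rw [idem_comm hi hei, ← mul_assoc, ← mul_assoc, hei, idem_comm hi hei, mul_assoc, hi]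

end BooleanDynamicalSystem

/-- By `cInvZero_isWide` the set `objs` contains every tight filter, so the unit space here is that
of the whole tight groupoid. Since arrows of the subgroupoid are arrows `γ` of the tight groupoid
bundled with a proof of `c γ = 0`, the substantial inclusion is `eq_id_of_c_eq_zero`. -/
theorem lemma7p3 {B : Type u} [GeneralizedBooleanAlgebra B] {L : Type v}
    (D : BooleanDynamicalSystem B L) :
    IsPrincipalGroupoid D.cInvZero.objs := by
  apply Set.Subset.antisymm
  · rintro ⟨x, y, γ⟩ (h : x = y)
    subst h
    refine ⟨x, ?_⟩
    have hγ : γ = 𝟙 x :=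
      -- The identity of the subgroupoid has the ambient identity as underlying arrow, and `γ.2` is
      -- by definition the statement `c γ.1 = 0`.
      Subtype.ext (BooleanDynamicalSystem.eq_id_of_c_eq_zero γ.1 γ.2)
    rw [hγ]
  · rintro _ ⟨x, rfl⟩
    rfl
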